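/- For a (possibly infinite) graph $G$ and a positive integer $r$, let $f_G(r) \in \mathbb{N} \cup \{\infty\}$ be the supremum of $|V(H)|$ over all subgraphs $H$ of $G$ of radius at most $r$. A tree-decomposition of $G$ is a family $(B_x)_{x \in V(T)}$ of subsets of $V(G)$ (bags) indexed by the nodes of a (possibly infinite) tree $T$, such that every edge of $G$ has both ends in some bag, and for every vertex $v$ of $G$ the set $\{x \in V(T) : v \in B_x\}$ induces a non-empty subtree of $T$. Its width is the supremum of the sizes of the bags, minus $1$, and the treewidth of $G$ is the minimum width of a tree-decomposition of $G$. Theorem. For every real number $c \geq 1$, every (finite or infinite) graph $G$ such that $f_G(r) \leq cr$ for every positive integer $r$ has treewidth at most $49c^2+30c$. -/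

import Mathlib

namespace LinearGrowth

universe u

/-- The growth of a graph `G`: `growth G r` is the supremum of the number of vertices of `H`, taken
over all subgraphs `H` of `G` with radius at most `r`. The radius of a disconnected or empty graph
is `⊤`, so the subgraphs that occur are connected and non-empty. -/
noncomputable def growth {V : Type u} (G : SimpleGraph V) (r : ℕ) : ℕ∞ :=
  ⨆ (H : G.Subgraph) (_ : H.coe.radius ≤ (r : ℕ∞)), H.verts.encard

/-- A tree-decomposition of `G`, indexed by the nodes of a tree with node set `X`. -/
structure TreeDecomposition {V : Type u} (G : SimpleGraph V) (X : Type u) where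
  /-- the underlying tree, finite or infinite, with at least one node -/
  tree : SimpleGraph X
  isTree : tree.IsTree
  /-- the bags -/
  bag : X → Set V
  /-- every edge of `G` has both ends in a common bag -/
  edge_mem : ∀ v w : V, G.Adj v w → ∃ x : X, v ∈ bag x ∧ w ∈ bag x
  /-- the nodes whose bags contain a given vertex induce a non-empty subtree -/
  subtree : ∀ v : V, (tree.induce {x : X | v ∈ bag x}).IsTree

/-- The width of a tree-decomposition: the supremum of the sizes of the bags, minus one. It is
`-1` if all bags are empty, and `⊤` if the sizes of the bags are unbounded or some bag is
infinite. -/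
noncomputable def TreeDecomposition.width {V : Type u} {G : SimpleGraph V} {X : Type u}
    (D : TreeDecomposition G X) : EReal :=
  (((⨆ x : X, (D.bag x).encard : ℕ∞) : ENNReal) : EReal) - 1

/-- The treewidth of a graph: the least width of a tree-decomposition. Widths lie in
`{-1, 0, 1, …, ⊤}`, so the infimum is attained. -/
noncomputable def treewidth {V : Type u} (G : SimpleGraph V) : EReal :=
  ⨅ (X : Type u) (D : TreeDecomposition G X), D.width

end LinearGrowth

/-!
Linear growth gives every finite vertex set `W` inside one component a balanced separator with at
most `10 * c ^ 2` vertices. Let `r` be the least radius such that some ball `B` of radius `r`, around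
any vertex, contains more than half of `W`. Cover `B` by balls of radius about `r / 2` around the
points of a maximal separated set. There are at most `5 * c` of them, since balls of radius about
`r / 4` around their centres are disjoint, have more than `r / 4` vertices each, and lie in a ball of
radius `5 * r / 4`. As the ball of radius `r` around a centre `u` has at most `c * r` vertices, one of
the spheres around `u` with radius between about `r / 2` and `r` has at most `2 * c` vertices. Let `X` be the union
of these spheres. A connected set that avoids `X` and has more than half of `W` meets `B`, hence lies
inside one of the spheres, that is, in a ball of radius less than `r`, and this contradicts the choice
of `r`. This is `HasLinearBalls.exists_balanced_separator`.

With `k = ⌊10 * c ^ 2⌋₊`, the usual recursion for bounding treewidth by balanced separators starts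
from the whole vertex set and splits a connected set `C` with at most `2 * k + 2` boundary vertices by
removing a balanced separator of its boundary, together with one further vertex. The components of the
rest again have at most `2 * k + 2` boundary vertices (`HasBalancedSeparators.exists_removal`), and the
bag at `C`, its boundary and the removed vertices, has size at most `3 * k + 3`. The further vertex is
the first one of `C` in a fixed enumeration of its component, which is countable because balls are
finite. So every vertex is removed after finitely many steps, and the recursion gives a
tree-decomposition also when `G` is infinite (`exists_treeDecomposition`), with no compactness argument.
-/

namespace LinearGrowth

universe u

variable {V : Type u} {G : SimpleGraph V}

/-! ### Balls, spheres and connected sets -/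

/-- The vertices at distance at most `r` from `v`. -/
def closedBall (G : SimpleGraph V) (v : V) (r : ℕ) : Set V := {x | G.edist v x ≤ r}

/-- The vertices at distance exactly `r` from `v`. -/
def sphere (G : SimpleGraph V) (v : V) (r : ℕ) : Set V := {x | G.edist v x = r}

/-- A connected vertex set that meets `P`, and from which no edge leaves `P`, lies in `P`. -/
theorem subset_of_preconnected {K P : Set V} (hK : (G.induce K).Preconnected)
    {x : V} (hx : x ∈ K) (hxP : x ∈ P)
    (h : ∀ a ∈ K, a ∈ P → ∀ b ∈ K, G.Adj a b → b ∈ P) : K ⊆ P := by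
  intro y hy
  obtain ⟨p⟩ := hK ⟨x, hx⟩ ⟨y, hy⟩
  have key : ∀ (a b : K) (_ : (G.induce K).Walk a b), a.1 ∈ P → b.1 ∈ P := by
    intro a b q
    induction q with
    | nil => exact id
    | cons hadj _ ih => exact fun ha => ih (h _ (Subtype.prop _) ha _ (Subtype.prop _) hadj)
  exact key _ _ p hxP

theorem edist_getVert_le {v u : V} (p : G.Walk v u) (i : ℕ) :
    G.edist v (p.getVert i) ≤ i :=
  (SimpleGraph.edist_le (p.take i)).trans (by
    rw [SimpleGraph.Walk.take_length]; exact_mod_cast min_le_left _ _)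

theorem encard_closedBall_le_growth (v : V) (r : ℕ) :
    (closedBall G v r).encard ≤ growth G r := by
  let H : G.Subgraph := (⊤ : G.Subgraph).induce (closedBall G v r)
  have hv : v ∈ closedBall G v r := by simp [closedBall]
  have hrad : H.coe.radius ≤ (r : ℕ∞) := by
    refine (SimpleGraph.radius_le_eccent (u := (⟨v, hv⟩ : H.verts))).trans ?_
    rw [SimpleGraph.eccent_le_iff]
    rintro ⟨u, hu⟩
    have hu' : G.edist v u ≤ r := hu
    obtain ⟨p, hp⟩ := SimpleGraph.exists_walk_of_edist_ne_top
      (ne_top_of_le_ne_top (ENat.natCast_ne_top r) hu')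
    have hlen : p.length ≤ r := by exact_mod_cast hp.trans_le hu'
    have hsupp : ∀ w ∈ p.support, w ∈ closedBall G v r := by
      intro w hw
      obtain ⟨i, rfl, hi⟩ := SimpleGraph.Walk.mem_support_iff_exists_getVert.1 hw
      exact (edist_getVert_le p i).trans (by exact_mod_cast hi.trans hlen)
    have key : (G.induce (closedBall G v r)).edist ⟨v, hv⟩ ⟨u, hu⟩ ≤ r := by
      refine (SimpleGraph.edist_le (p.induce _ hsupp)).trans ?_
      have := congrArg SimpleGraph.Walk.length (SimpleGraph.Walk.map_induce p hsupp)
      rw [SimpleGraph.Walk.length_map] at this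
      rw [this]; exact_mod_cast hlen
    rw [SimpleGraph.induce_eq_coe_induce_top] at key
    exact key
  exact le_iSup₂_of_le (f := fun (H : G.Subgraph) (_ : H.coe.radius ≤ (r : ℕ∞)) =>
    H.verts.encard) H hrad le_rfl

/-- Distances from `u` take every value below one that they attain. -/
theorem exists_edist_eq {u y : V} (huy : G.Reachable u y) {i : ℕ}
    (hi : (i : ℕ∞) ≤ G.edist u y) : ∃ z, G.edist u z = i := by
  obtain ⟨p, hp⟩ := huy.exists_walk_length_eq_edist
  have hil : i ≤ p.length := by rw [← hp] at hi; exact_mod_cast hi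
  refine ⟨p.getVert i, le_antisymm (edist_getVert_le p i) ?_⟩
  have h1 := SimpleGraph.edist_le (p.drop i)
  rw [SimpleGraph.Walk.drop_length] at h1
  have h2 : G.edist u y ≤ G.edist u (p.getVert i) + G.edist (p.getVert i) y :=
    SimpleGraph.edist_triangle
  have h3 := (edist_getVert_le p i)
  lift G.edist u (p.getVert i) to ℕ using ne_top_of_le_ne_top (ENat.natCast_ne_top i) h3 with a
  lift G.edist (p.getVert i) y to ℕ using ne_top_of_le_ne_top (ENat.natCast_ne_top _) h1 with b
  rw [← hp] at h2
  norm_cast at *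
  omega

/-- A connected set that avoids a sphere and meets its inside lies inside. -/
theorem subset_closedBall_of_disjoint_sphere {K : Set V} (hK : (G.induce K).Preconnected)
    {u x : V} {s : ℕ} (hdisj : Disjoint K (sphere G u (s + 1))) (hx : x ∈ K)
    (hxs : x ∈ closedBall G u s) : K ⊆ closedBall G u s := by
  refine subset_of_preconnected hK hx hxs fun a _ haP b hb hab => ?_
  have h1 : G.edist u b ≤ G.edist u a + G.edist a b := SimpleGraph.edist_triangle
  rw [SimpleGraph.edist_eq_one_iff_adj.2 hab] at h1
  have h2 : G.edist u b ≠ ((s + 1 : ℕ) : ℕ∞) := fun h => Set.disjoint_left.1 hdisj hb h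
  have h3 : G.edist u b ≤ ((s + 1 : ℕ) : ℕ∞) :=
    h1.trans (by push_cast; gcongr; exact haP)
  have h4 := lt_of_le_of_ne h3 h2
  push_cast at h4
  exact (ENat.lt_natCast_add_one_iff).1 h4

/-- Linear growth with constant `c`, in terms of closed balls. Finiteness is stated separately as
`ncard` is `0` on infinite sets. -/
def HasLinearBalls (G : SimpleGraph V) (c : ℝ) : Prop :=
  ∀ (v : V) (r : ℕ), 1 ≤ r → (closedBall G v r).Finite ∧ ((closedBall G v r).ncard : ℝ) ≤ c * r

theorem hasLinearBalls_of_growth_le {c : ℝ}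
    (hG : ∀ r : ℕ, 1 ≤ r → ((growth G r : ENNReal) : EReal) ≤ ((c * (r : ℝ) : ℝ) : EReal)) :
    HasLinearBalls G c := by
  intro v r hr
  have h1 : (((closedBall G v r).encard : ENNReal) : EReal) ≤ ((c * (r : ℝ) : ℝ) : EReal) := by
    refine le_trans ?_ (hG r hr)
    exact_mod_cast encard_closedBall_le_growth v r
  have hfin : (closedBall G v r).Finite := by
    rw [← Set.encard_ne_top_iff]
    intro h
    rw [h] at h1
    exact EReal.coe_ne_top _ (top_le_iff.1 h1)
  refine ⟨hfin, ?_⟩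
  rw [← hfin.cast_ncard_eq] at h1
  have h2 : ((((closedBall G v r).ncard : ℝ)) : EReal) ≤ ((c * (r : ℝ) : ℝ) : EReal) := by
    rw [ENat.toENNReal_coe] at h1
    exact h1
  exact EReal.coe_le_coe_iff.1 h2

/-! ### Balanced separators -/

/-- Pigeonhole over the spheres between radii `m` and `r`, which are disjoint and lie in a ball
with at most `c * r` vertices. -/
theorem HasLinearBalls.exists_small_sphere {c : ℝ} (hb : HasLinearBalls G c) (u : V)
    {m r : ℕ} (hmr : m < r) :
    ∃ s, m ≤ s ∧ s < r ∧ (sphere G u (s + 1)).Finite ∧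
      ((r - m : ℕ) : ℝ) * (sphere G u (s + 1)).ncard ≤ c * r := by
  classical
  obtain ⟨hfin, hcard⟩ := hb u r (by omega)
  rw [Set.ncard_eq_toFinset_card _ hfin] at hcard
  have hpos : (0 : ℝ) < ((r - m : ℕ) : ℝ) := by exact_mod_cast Nat.sub_pos_of_lt hmr
  obtain ⟨s, hs, hfib⟩ := Finset.exists_card_fiber_le_of_card_le_nsmul
    (s := hfin.toFinset) (t := Finset.Ico m r)
    (f := fun x => (G.edist u x).toNat - 1) (b := c * r / ((r - m : ℕ) : ℝ))
    (Finset.nonempty_Ico.2 hmr) (by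
      rw [Nat.card_Ico, nsmul_eq_mul, mul_div_cancel₀ _ hpos.ne']
      exact hcard)
  rw [Finset.mem_Ico] at hs
  have hsub : sphere G u (s + 1) ⊆
      ((hfin.toFinset.filter fun x => (G.edist u x).toNat - 1 = s : Finset V) : Set V) := by
    intro x hx
    have hx' : G.edist u x = ((s + 1 : ℕ) : ℕ∞) := hx
    have : x ∈ closedBall G u r := by
      change G.edist u x ≤ r
      rw [hx']; exact_mod_cast hs.2
    simp [this, hx', -Nat.cast_add]
  refine ⟨s, hs.1, hs.2, (Finset.finite_toSet _).subset hsub, ?_⟩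
  have h1 := Set.ncard_le_ncard hsub (Finset.finite_toSet _)
  rw [Set.ncard_coe_finset] at h1
  rw [le_div_iff₀ hpos] at hfib
  have h2 : ((sphere G u (s + 1)).ncard : ℝ) ≤ _ := Nat.cast_le.2 h1
  rw [mul_comm]
  exact (mul_le_mul_of_nonneg_right h2 hpos.le).trans hfib

/-- A maximal subset of `B` with distances more than `t` is a `t`-net of `B`. -/
theorem exists_separated_net (G : SimpleGraph V) {B : Set V} (hB : B.Finite) (t : ℕ) :
    ∃ U : Finset V, (U : Set V) ⊆ B ∧
      (∀ x ∈ U, ∀ y ∈ U, x ≠ y → (t : ℕ∞) < G.edist x y) ∧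
      ∀ x ∈ B, ∃ u ∈ U, G.edist u x ≤ t := by
  classical
  let F := hB.toFinset.powerset.filter
    fun U => ∀ x ∈ U, ∀ y ∈ U, x ≠ y → (t : ℕ∞) < G.edist x y
  obtain ⟨U, hU, hmax⟩ := F.exists_max_image Finset.card ⟨∅, by simp [F]⟩
  simp only [F, Finset.mem_filter, Finset.mem_powerset] at hU hmax
  refine ⟨U, fun x hx => by simpa using hU.1 hx, hU.2, fun x hx => ?_⟩
  by_contra! hcon
  have hxU : x ∉ U := fun h => by simpa using hcon x h
  have := hmax (insert x U) ⟨Finset.insert_subset (by simpa using hx) hU.1, by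
    intro a ha b hb hab
    rw [Finset.mem_insert] at ha hb
    rcases ha with rfl | ha <;> rcases hb with rfl | hb
    · exact absurd rfl hab
    · rw [SimpleGraph.edist_comm]; exact hcon _ hb
    · exact hcon _ ha
    · exact hU.2 a ha b hb hab⟩
  rw [Finset.card_insert_of_notMem hxU] at this
  omega

/-- A ball that does not exhaust the component of its centre has more vertices than its radius. -/
theorem exists_finset_subset_closedBall {u y : V} (huy : G.Reachable u y) {h : ℕ}
    (hy : (h : ℕ∞) ≤ G.edist u y) :
    ∃ S : Finset V, (S : Set V) ⊆ closedBall G u h ∧ S.card = h + 1 := by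
  classical
  have : Nonempty V := ⟨u⟩
  choose! z hz using fun i (hi : i ≤ h) =>
    exists_edist_eq huy ((Nat.cast_le.2 hi).trans hy)
  refine ⟨(Finset.range (h + 1)).image z, ?_, ?_⟩
  · intro x hx
    simp only [Finset.coe_image, Finset.coe_range, Set.mem_image, Set.mem_Iio] at hx
    obtain ⟨i, hi, rfl⟩ := hx
    change G.edist u (z i) ≤ h
    rw [hz i (by omega)]
    exact_mod_cast (by omega : i ≤ h)
  · rw [Finset.card_image_of_injOn, Finset.card_range]
    intro i hi j hj hij
    simp only [Finset.coe_range, Set.mem_Iio] at hi hj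
    have h1 := hz i (by omega)
    rw [hij, hz j (by omega)] at h1
    exact_mod_cast h1.symm

/-- The balls of radius `h` around the points of a `2h`-separated set are disjoint, so their number
is bounded by the size of a slightly larger ball. -/
theorem HasLinearBalls.card_mul_le_of_separated {c : ℝ} (hb : HasLinearBalls G c) {v : V}
    {r h : ℕ} (hr : 1 ≤ r) {U : Finset V} (hU : (U : Set V) ⊆ closedBall G v r)
    (hsep : ∀ x ∈ U, ∀ y ∈ U, x ≠ y → ((2 * h : ℕ) : ℕ∞) < G.edist x y)
    (hfar : ∀ u ∈ U, ∃ y, G.Reachable u y ∧ (h : ℕ∞) ≤ G.edist u y) :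
    (U.card : ℝ) * (h + 1) ≤ c * (r + h) := by
  classical
  obtain ⟨hfin, hcard⟩ := hb v (r + h) (by omega)
  rw [Set.ncard_eq_toFinset_card _ hfin] at hcard
  have hS : ∀ u ∈ U, ∃ S : Finset V, (S : Set V) ⊆ closedBall G u h ∧ S.card = h + 1 :=
    fun u hu => by
      obtain ⟨y, hy, hy'⟩ := hfar u hu
      exact exists_finset_subset_closedBall hy hy'
  choose! S hSsub hScard using hS
  have hdisj : (U : Set V).PairwiseDisjoint S := by
    intro x hx y hy hxy
    rw [Function.onFun, Finset.disjoint_left]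
    intro z hzx hzy
    have h1 : G.edist x z ≤ h := hSsub x hx hzx
    have h2 : G.edist y z ≤ h := hSsub y hy hzy
    rw [SimpleGraph.edist_comm] at h2
    refine (hsep x hx y hy hxy).not_ge ?_
    calc G.edist x y ≤ G.edist x z + G.edist z y := SimpleGraph.edist_triangle
      _ ≤ h + h := add_le_add h1 h2
      _ = ((2 * h : ℕ) : ℕ∞) := by push_cast; ring
  have hcardU : (U.biUnion S).card = U.card * (h + 1) := by
    rw [Finset.card_biUnion hdisj, Finset.sum_congr rfl hScard, Finset.sum_const, smul_eq_mul]
  have hsub : U.biUnion S ⊆ hfin.toFinset := by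
    intro z hz
    obtain ⟨u, hu, hzu⟩ := Finset.mem_biUnion.1 hz
    rw [Set.Finite.mem_toFinset]
    have h1 : G.edist v u ≤ r := hU hu
    have h2 : G.edist u z ≤ h := hSsub u hu hzu
    change G.edist v z ≤ ((r + h : ℕ) : ℕ∞)
    push_cast
    exact SimpleGraph.edist_triangle.trans (add_le_add h1 h2)
  have h3 := Finset.card_le_card hsub
  rw [hcardU] at h3
  have h4 : ((U.card * (h + 1) : ℕ) : ℝ) ≤ _ := Nat.cast_le.2 h3
  push_cast at h4 hcard
  exact h4.trans hcard

/-- In a graph of linear growth, every finite set `W` inside one component has a balanced separator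
of bounded size: a set `X` such that no connected set that avoids `X` has more than half of `W`. -/
theorem HasLinearBalls.exists_balanced_separator {c : ℝ} (hc : 1 ≤ c) (hb : HasLinearBalls G c)
    {W : Set V} (hWfin : W.Finite) (hW : ∀ x ∈ W, ∀ y ∈ W, G.Reachable x y) :
    ∃ X : Set V, X.Finite ∧ (X.ncard : ℝ) ≤ 10 * c ^ 2 ∧
      ∀ K : Set V, (G.induce K).Preconnected → Disjoint K X →
        2 * (W ∩ K).ncard ≤ W.ncard := by
  classical
  by_cases hW1 : W.ncard ≤ 1
  · refine ⟨W, hWfin, ?_, fun K _ hK => ?_⟩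
    · have : (W.ncard : ℝ) ≤ 1 := by exact_mod_cast hW1
      nlinarith
    · rw [Set.inter_comm, hK.inter_eq]; simp
  push Not at hW1
  -- the least radius of a ball with more than half of `W`
  have hex : ∃ r : ℕ, ∃ v, W.ncard < 2 * (W ∩ closedBall G v r).ncard := by
    obtain ⟨v, hv⟩ := Set.nonempty_of_ncard_ne_zero (s := W) (by omega)
    obtain ⟨r, hr⟩ : ∃ r : ℕ, ∀ w ∈ W, (G.edist v w).toNat ≤ r := by
      obtain ⟨r, hr⟩ := (hWfin.image fun w => (G.edist v w).toNat).bddAbove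
      exact ⟨r, fun w hw => hr ⟨w, hw, rfl⟩⟩
    refine ⟨r, v, ?_⟩
    have : W ∩ closedBall G v r = W := by
      refine Set.inter_eq_left.2 fun w hw => ?_
      have h1 := hr w hw
      have h2 := SimpleGraph.edist_ne_top_iff_reachable.2 (hW v hv w hw)
      change G.edist v w ≤ r
      rw [← ENat.natCast_toNat h2]
      exact_mod_cast h1
    rw [this]; omega
  obtain ⟨r, ⟨v, hv⟩, hmin⟩ : ∃ r : ℕ, (∃ v, W.ncard < 2 * (W ∩ closedBall G v r).ncard) ∧
      ∀ s < r, ∀ u, 2 * (W ∩ closedBall G u s).ncard ≤ W.ncard :=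
    ⟨Nat.find hex, Nat.find_spec hex, fun s hs u => by
      have := Nat.find_min hex hs
      push Not at this
      exact this u⟩
  have hr : 1 ≤ r := by
    by_contra! h0
    obtain rfl : r = 0 := by omega
    have : W ∩ closedBall G v 0 ⊆ {v} := by
      rintro x ⟨_, hx⟩
      have hx' : G.edist v x ≤ (0 : ℕ) := hx
      exact (SimpleGraph.edist_eq_zero_iff.1 (nonpos_iff_eq_zero.1 hx')).symm
    have := Set.ncard_le_ncard this
    rw [Set.ncard_singleton] at this
    omega
  have hfar : ∀ u ∈ closedBall G v r, ∃ y, G.Reachable u y ∧ (r : ℕ∞) ≤ G.edist u y := by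
    intro u hu
    have hnot : ¬ W ⊆ closedBall G u (r - 1) := fun h => by
      have := hmin (r - 1) (by omega) u
      rw [Set.inter_eq_left.2 h] at this
      omega
    obtain ⟨y, hyW, hy⟩ := Set.not_subset.1 hnot
    obtain ⟨x, hxW, hx⟩ := Set.nonempty_of_ncard_ne_zero
      (s := W ∩ closedBall G v r) (by omega)
    have hreach : ∀ {z}, z ∈ closedBall G v r → G.Reachable v z := fun hz =>
      SimpleGraph.reachable_of_edist_ne_top (ne_top_of_le_ne_top (ENat.natCast_ne_top r) hz)
    refine ⟨y, (hreach hu).symm.trans ((hreach hx).trans (hW x hxW y hyW)), ?_⟩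
    have hy' : ¬ G.edist u y ≤ ((r - 1 : ℕ) : ℕ∞) := hy
    rw [not_le] at hy'
    have := Order.add_one_le_of_lt hy'
    have hr' : ((r - 1 : ℕ) : ℕ∞) + 1 = r := by exact_mod_cast Nat.sub_add_cancel hr
    rwa [hr'] at this
  -- at scale `h ≈ r / 4`, at most `5 * c` balls of radius `2 * h` cover the ball around `v`, and
  -- each of their centres has a sphere of radius in `(2 * h, r]` with at most `2 * c` vertices
  obtain ⟨h, hh1, hh2⟩ : ∃ h : ℕ, 4 * h ≤ r ∧ r < 4 * (h + 1) := ⟨r / 4, by omega, by omega⟩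
  obtain ⟨U, hUsub, hUsep, hUnet⟩ := exists_separated_net G (hb v r hr).1 (2 * h)
  have hUcard := hb.card_mul_le_of_separated hr hUsub hUsep fun u hu => by
    obtain ⟨y, hy, hy'⟩ := hfar u (hUsub hu)
    exact ⟨y, hy, (Nat.cast_le.2 (by omega : h ≤ r)).trans hy'⟩
  choose s hs1 hs2 hsfin hscard using fun u => hb.exists_small_sphere u (by omega : 2 * h < r)
  have hr0 : (0 : ℝ) < r := by exact_mod_cast hr
  have hU5 : (U.card : ℝ) ≤ 5 * c := by
    have e1 : (4 * h : ℝ) ≤ r := by exact_mod_cast hh1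
    have e2 : (r : ℝ) < 4 * (h + 1) := by exact_mod_cast hh2
    have e3 : (U.card : ℝ) * r ≤ 5 * c * r := by nlinarith [(Nat.cast_nonneg U.card : (0:ℝ) ≤ _)]
    exact le_of_mul_le_mul_right e3 hr0
  have hS2 : ∀ u, ((sphere G u (s u + 1)).ncard : ℝ) ≤ 2 * c := fun u => by
    have e1 : (r : ℝ) ≤ 2 * ((r - 2 * h : ℕ) : ℝ) := by
      exact_mod_cast (by omega : r ≤ 2 * (r - 2 * h))
    have e3 : ((sphere G u (s u + 1)).ncard : ℝ) * r ≤ 2 * c * r := by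
      nlinarith [hscard u, (Nat.cast_nonneg (sphere G u (s u + 1)).ncard : (0:ℝ) ≤ _)]
    exact le_of_mul_le_mul_right e3 hr0
  refine ⟨⋃ u ∈ U, sphere G u (s u + 1), U.finite_toSet.biUnion fun u _ => hsfin u, ?_, ?_⟩
  · have e1 : (⋃ u ∈ U, sphere G u (s u + 1)).ncard ≤ ∑ u ∈ U, (sphere G u (s u + 1)).ncard :=
      Finset.set_ncard_biUnion_le U _
    calc ((⋃ u ∈ U, sphere G u (s u + 1)).ncard : ℝ)
        ≤ ∑ u ∈ U, ((sphere G u (s u + 1)).ncard : ℝ) := by exact_mod_cast e1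
      _ ≤ ∑ u ∈ U, 2 * c := Finset.sum_le_sum fun u _ => hS2 u
      _ = U.card * (2 * c) := by rw [Finset.sum_const, nsmul_eq_mul]
      _ ≤ 5 * c * (2 * c) := by gcongr
      _ = 10 * c ^ 2 := by ring
  · intro K hK hdisj
    by_contra! hbig
    -- two sets that each have more than half of `W` intersect
    obtain ⟨x, hxK, hxB⟩ : (K ∩ closedBall G v r).Nonempty := by
      by_contra hemp
      have hd : Disjoint (W ∩ K) (W ∩ closedBall G v r) := by
        rw [Set.not_nonempty_iff_eq_empty, ← Set.disjoint_iff_inter_eq_empty] at hemp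
        exact hemp.mono Set.inter_subset_right Set.inter_subset_right
      have e1 := Set.ncard_union_eq hd (hWfin.inter_of_left _) (hWfin.inter_of_left _)
      have e2 := Set.ncard_le_ncard (Set.union_subset (Set.inter_subset_left (s := W) (t := K))
        (Set.inter_subset_left (s := W) (t := closedBall G v r))) hWfin
      omega
    -- so `K` is caught inside a sphere of radius at most `r` around a point of the net, which
    -- contradicts the minimality of `r`
    obtain ⟨u, hu, hux⟩ := hUnet x hxB
    have hKu : K ⊆ closedBall G u (s u) :=
      subset_closedBall_of_disjoint_sphere hK
        (hdisj.mono_right (Set.subset_biUnion_of_mem (u := fun u => sphere G u (s u + 1)) hu)) hxK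
        (hux.trans (Nat.cast_le.2 (hs1 u)))
    have e1 := hmin (s u) (hs2 u) u
    have e2 := Set.ncard_le_ncard (Set.inter_subset_inter_right W hKu) (hWfin.inter_of_left _)
    omega

/-! ### Rooted trees given by parents -/

section RootedTree

variable {X : Type u} (depth : X → ℕ) (parent : X → X)

/-- The graph in which each node of nonzero depth is joined to its parent. -/
def parentGraph : SimpleGraph X :=
  SimpleGraph.fromRel fun x y => depth x ≠ 0 ∧ parent x = y

variable {depth parent}

theorem parentGraph_adj_parent (hdepth : ∀ x, depth x ≠ 0 → depth (parent x) + 1 = depth x)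
    {x : X} (hx : depth x ≠ 0) : (parentGraph depth parent).Adj x (parent x) := by
  refine ⟨fun h => ?_, Or.inl ⟨hx, rfl⟩⟩
  have := hdepth x hx
  rw [← h] at this
  omega

theorem parent_eq_of_adj (hdepth : ∀ x, depth x ≠ 0 → depth (parent x) + 1 = depth x)
    {x y : X} (h : (parentGraph depth parent).Adj x y) (hxy : depth y ≤ depth x) :
    parent x = y := by
  rcases h.2 with ⟨_, h⟩ | ⟨hy, h⟩
  · exact h
  · have := hdepth y hy
    rw [h] at this
    omega

theorem parentGraph_isAcyclic (hdepth : ∀ x, depth x ≠ 0 → depth (parent x) + 1 = depth x) :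
    (parentGraph depth parent).IsAcyclic := by
  classical
  intro v c hc
  -- both neighbours on the cycle of a deepest node are its parent
  obtain ⟨x, hx, hmax⟩ := c.support.toFinset.exists_max_image depth ⟨v, by simp⟩
  rw [List.mem_toFinset] at hx
  have hmax' : ∀ y ∈ (c.rotate x hx).support, depth y ≤ depth x := fun y hy =>
    hmax y (List.mem_toFinset.2 ((c.mem_support_rotate_iff x hx).1 hy))
  have hc' := hc.rotate hx
  refine hc'.snd_ne_penultimate ?_
  have h1 := parent_eq_of_adj hdepth (SimpleGraph.Walk.adj_snd hc'.not_nil)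
    (hmax' _ (SimpleGraph.Walk.getVert_mem_support _ _))
  have h2 := parent_eq_of_adj hdepth (SimpleGraph.Walk.adj_penultimate hc'.not_nil).symm
    (hmax' _ (SimpleGraph.Walk.getVert_mem_support _ _))
  exact h1.symm.trans h2

/-- A set of nodes in which all nodes but one have their parent in the set induces a tree. -/
theorem parentGraph_induce_isTree
    (hdepth : ∀ x, depth x ≠ 0 → depth (parent x) + 1 = depth x) {S : Set X} {t : X} (ht : t ∈ S)
    (hS : ∀ x ∈ S, x ≠ t → depth x ≠ 0 ∧ parent x ∈ S) :
    ((parentGraph depth parent).induce S).IsTree := by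
  have key : ∀ n, ∀ x (hx : x ∈ S), depth x = n →
      ((parentGraph depth parent).induce S).Reachable ⟨x, hx⟩ ⟨t, ht⟩ := by
    intro n
    induction n with
    | zero =>
      intro x hx h0
      by_cases hxt : x = t
      · subst hxt; rfl
      · exact absurd h0 (hS x hx hxt).1
    | succ n ih =>
      intro x hx hn
      by_cases hxt : x = t
      · subst hxt; rfl
      · obtain ⟨h0, hp⟩ := hS x hx hxt
        have hd := hdepth x h0
        have hadj : ((parentGraph depth parent).induce S).Adj ⟨x, hx⟩ ⟨parent x, hp⟩ :=
          parentGraph_adj_parent hdepth h0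
        exact hadj.reachable.trans (ih _ hp (by omega))
  have : Nonempty S := ⟨⟨t, ht⟩⟩
  exact
    { preconnected := fun x y => (key _ x.1 x.2 rfl).trans (key _ y.1 y.2 rfl).symm
      isAcyclic := (parentGraph_isAcyclic hdepth).induce S }

theorem parentGraph_isTree (hdepth : ∀ x, depth x ≠ 0 → depth (parent x) + 1 = depth x) {t : X}
    (ht : ∀ x, x ≠ t → depth x ≠ 0) : (parentGraph depth parent).IsTree := by
  have := parentGraph_induce_isTree hdepth (Set.mem_univ t) fun x _ hx => ⟨ht x hx, Set.mem_univ _⟩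
  exact (SimpleGraph.induceUnivIso _).isTree_iff.1 this

end RootedTree

/-! ### Tree-decompositions from recursive splitting -/

/-- The vertices outside `C` with a neighbour in `C`. -/
def boundary (G : SimpleGraph V) (C : Set V) : Set V := {x | x ∉ C ∧ ∃ y ∈ C, G.Adj y x}

/-- The pieces at level `n` of the recursive decomposition in which a piece `C` is split into the
components of `C \ A C`. At level `0` there is just the piece `univ`. -/
inductive IsPiece (G : SimpleGraph V) (A : Set V → Set V) : ℕ → Set V → Prop
  | root : IsPiece G A 0 Set.univ
  | child {n : ℕ} {C : Set V} (hC : IsPiece G A n C)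
      (K : (G.induce (C \ A C)).ConnectedComponent) :
      IsPiece G A (n + 1) (Subtype.val '' K.supp)

theorem image_supp_subset {S : Set V} (K : (G.induce S).ConnectedComponent) :
    Subtype.val '' K.supp ⊆ S := by
  rintro _ ⟨x, _, rfl⟩
  exact x.2

theorem disjoint_boundary_image_supp {S : Set V} (K : (G.induce S).ConnectedComponent) :
    Disjoint (boundary G (Subtype.val '' K.supp)) S := by
  rw [Set.disjoint_left]
  rintro x ⟨hxK, _, ⟨y, hy, rfl⟩, hadj⟩ hxS
  refine hxK ⟨⟨x, hxS⟩, ?_, rfl⟩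
  exact (SimpleGraph.ConnectedComponent.mem_supp_congr_adj K
    (show (G.induce S).Adj y ⟨x, hxS⟩ from hadj)).1 hy

theorem boundary_image_supp_subset {C T : Set V}
    (K : (G.induce (C \ T)).ConnectedComponent) :
    boundary G (Subtype.val '' K.supp) ⊆ boundary G C ∪ T := by
  intro x hx
  by_cases hxT : x ∈ T
  · exact Or.inr hxT
  · refine Or.inl ⟨fun hxC => ?_, ?_⟩
    · exact Set.disjoint_left.1 (disjoint_boundary_image_supp K) hx ⟨hxC, hxT⟩
    · obtain ⟨_, y, hy, hadj⟩ := hx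
      exact ⟨y, (image_supp_subset K hy).1, hadj⟩

theorem IsPiece.exists_parent {A : Set V → Set V} {n : ℕ} {C : Set V}
    (h : IsPiece G A (n + 1) C) :
    ∃ P, IsPiece G A n P ∧ C ⊆ P \ A P ∧ boundary G C ⊆ boundary G P ∪ A P := by
  cases h with
  | child hC K => exact ⟨_, hC, image_supp_subset K, boundary_image_supp_subset K⟩

/-- Distinct pieces at the same level are disjoint. -/
theorem IsPiece.eq_of_mem {A : Set V → Set V} {n : ℕ} {C D : Set V} (hC : IsPiece G A n C)
    (hD : IsPiece G A n D) {v : V} (hvC : v ∈ C) (hvD : v ∈ D) : C = D := by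
  induction n generalizing C D with
  | zero => cases hC; cases hD; rfl
  | succ n ih =>
    cases hC with
    | @child _ C' hC' K =>
      cases hD with
      | @child _ D' hD' L =>
        obtain rfl := ih hC' hD' (image_supp_subset K hvC).1 (image_supp_subset L hvD).1
        obtain ⟨x, hx, rfl⟩ := hvC
        obtain ⟨y, hy, hxy⟩ := hvD
        obtain rfl := Subtype.ext hxy
        rw [SimpleGraph.ConnectedComponent.mem_supp_iff] at hx hy
        rw [← hx, ← hy]

theorem IsPiece.exists_ancestor {A : Set V → Set V} {n : ℕ} {C : Set V} (hC : IsPiece G A n C)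
    {m : ℕ} (hm : m < n) : ∃ P, IsPiece G A m P ∧ C ⊆ P \ A P := by
  induction n generalizing C with
  | zero => omega
  | succ n ih =>
    obtain ⟨P, hP, hCP, _⟩ := hC.exists_parent
    rcases (Nat.lt_succ_iff.1 hm).lt_or_eq with h | rfl
    · obtain ⟨Q, hQ, hPQ⟩ := ih hP h
      exact ⟨Q, hQ, (hCP.trans Set.sdiff_subset).trans hPQ⟩
    · exact ⟨P, hP, hCP⟩

theorem IsPiece.level_le {A : Set V → Set V} (hA : ∀ C, A C ⊆ C) {m n : ℕ} {C D : Set V}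
    (hC : IsPiece G A n C) (hD : IsPiece G A m D) {v : V} (hvC : v ∈ C) (hvD : v ∈ A D) :
    n ≤ m := by
  by_contra! h
  obtain ⟨P, hP, hCP⟩ := hC.exists_ancestor h
  obtain rfl := hP.eq_of_mem hD (hCP hvC).1 (hA _ hvD)
  exact (hCP hvC).2 hvD

/-- The recursive decomposition gives a tree-decomposition with bags `boundary G C ∪ A C`, as soon
as every vertex lies in `A C` for some piece `C`. -/
theorem exists_treeDecomposition {A : Set V → Set V} (hA : ∀ C, A C ⊆ C)
    (hcov : ∀ v, ∃ n C, IsPiece G A n C ∧ v ∈ A C) :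
    ∃ (X : Type u) (D : TreeDecomposition G X), ∀ x, ∃ n C, IsPiece G A n C ∧
      D.bag x = boundary G C ∪ A C := by
  classical
  let X := {p : ℕ × Set V // IsPiece G A p.1 p.2}
  let depth : X → ℕ := fun x => x.1.1
  have hpar : ∀ x : X, ∃ y : X, depth x ≠ 0 → depth y + 1 = depth x ∧
      boundary G x.1.2 ⊆ boundary G y.1.2 ∪ A y.1.2 := by
    rintro ⟨⟨n, C⟩, hC⟩
    cases n with
    | zero => exact ⟨⟨⟨0, C⟩, hC⟩, fun h => absurd rfl h⟩
    | succ n =>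
      obtain ⟨P, hP, _, h⟩ := IsPiece.exists_parent hC
      exact ⟨⟨⟨n, P⟩, hP⟩, fun _ => ⟨rfl, h⟩⟩
  choose parent hparent using hpar
  have hdepth : ∀ x, depth x ≠ 0 → depth (parent x) + 1 = depth x := fun x hx => (hparent x hx).1
  have hroot : ∀ x : X, depth x = 0 → x.1.2 = Set.univ := by
    rintro ⟨⟨n, C⟩, hC⟩ (h : n = 0)
    subst h
    cases hC
    rfl
  refine ⟨X, ⟨parentGraph depth parent, ?_, fun x => boundary G x.1.2 ∪ A x.1.2, ?_, ?_⟩,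
    fun x => ⟨x.1.1, x.1.2, x.2, rfl⟩⟩
  · refine parentGraph_isTree hdepth (t := ⟨⟨0, Set.univ⟩, IsPiece.root⟩) fun x hx h0 => hx ?_
    exact Subtype.ext (Prod.ext h0 (hroot x h0))
  · -- of the pieces that contain `v` or `w` in the part removed, take the one at the lower level
    have key : ∀ v w, G.Adj v w → ∀ m n C D, IsPiece G A m C → IsPiece G A n D →
        v ∈ A C → w ∈ A D → m ≤ n →
        ∃ x : X, v ∈ boundary G x.1.2 ∪ A x.1.2 ∧ w ∈ boundary G x.1.2 ∪ A x.1.2 := by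
      intro v w hvw m n C D hC hD hv hw hmn
      refine ⟨⟨⟨n, D⟩, hD⟩, ?_, Or.inr hw⟩
      by_cases hvD : v ∈ D
      · obtain rfl := le_antisymm hmn (hD.level_le hA hC hvD hv)
        obtain rfl := hC.eq_of_mem hD (hA _ hv) hvD
        exact Or.inr hv
      · exact Or.inl ⟨hvD, w, hA _ hw, hvw.symm⟩
    intro v w hvw
    obtain ⟨m, C, hC, hv⟩ := hcov v
    obtain ⟨n, D, hD, hw⟩ := hcov w
    rcases le_total m n with h | h
    · exact key v w hvw m n C D hC hD hv hw h
    · obtain ⟨x, h1, h2⟩ := key w v hvw.symm n m D C hD hC hw hv h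
      exact ⟨x, h2, h1⟩
  · intro v
    obtain ⟨m, C, hC, hv⟩ := hcov v
    refine parentGraph_induce_isTree hdepth (t := ⟨⟨m, C⟩, hC⟩) (Or.inr hv) ?_
    rintro x (hx | hx) hxt
    · have h0 : depth x ≠ 0 := fun h0 => hx.1 (by rw [hroot x h0]; trivial)
      exact ⟨h0, (hparent x h0).2 hx⟩
    · refine absurd ?_ hxt
      have h1 := le_antisymm (x.2.level_le hA hC (hA _ hx) hv) (hC.level_le hA x.2 (hA _ hv) hx)
      have h2 := IsPiece.eq_of_mem (h1 ▸ x.2) hC (hA _ hx) (hA _ hv)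
      exact Subtype.ext (Prod.ext h1 h2)

/-! ### Splitting along balanced separators -/

theorem preconnected_induce_image_supp {S : Set V} (K : (G.induce S).ConnectedComponent) :
    (G.induce (Subtype.val '' K.supp)).Preconnected := by
  let f : K.toSimpleGraph →g G.induce (Subtype.val '' K.supp) :=
    ⟨fun x => ⟨x.1.1, x.1, x.2, rfl⟩, fun {a b} h => h⟩
  rintro ⟨_, x, hx, rfl⟩ ⟨_, y, hy, rfl⟩
  exact (K.connected_toSimpleGraph.preconnected ⟨x, hx⟩ ⟨y, hy⟩).map f

theorem reachable_of_preconnected_induce {K : Set V} (hK : (G.induce K).Preconnected) {x y : V}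
    (hx : x ∈ K) (hy : y ∈ K) : G.Reachable x y :=
  (hK ⟨x, hx⟩ ⟨y, hy⟩).map (SimpleGraph.Embedding.induce K).toHom

theorem preconnected_induce_union {K Z : Set V} (hK : (G.induce K).Preconnected)
    (hZ : ∀ z ∈ Z, ∃ y ∈ K, G.Adj y z) : (G.induce (K ∪ Z)).Preconnected := by
  have key : ∀ z : (K ∪ Z : Set V), ∃ y, ∃ hy : y ∈ K,
      (G.induce (K ∪ Z)).Reachable z ⟨y, Or.inl hy⟩ := by
    rintro ⟨z, hz | hz⟩
    · exact ⟨z, hz, SimpleGraph.Reachable.refl _⟩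
    · obtain ⟨y, hy, hyz⟩ := hZ z hz
      have : (G.induce (K ∪ Z)).Adj ⟨z, Or.inr hz⟩ ⟨y, Or.inl hy⟩ := hyz.symm
      exact ⟨y, hy, this.reachable⟩
  intro a b
  obtain ⟨x, hx, hax⟩ := key a
  obtain ⟨y, hy, hby⟩ := key b
  exact hax.trans (((hK ⟨x, hx⟩ ⟨y, hy⟩).map
    (SimpleGraph.induceHomOfLE G Set.subset_union_left).toHom).trans hby.symm)

theorem reachable_of_mem_boundary {C : Set V} (hC : (G.induce C).Preconnected) {x y : V}
    (hx : x ∈ boundary G C) (hy : y ∈ boundary G C) : G.Reachable x y := by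
  obtain ⟨_, a, ha, hax⟩ := hx
  obtain ⟨_, b, hb, hby⟩ := hy
  exact hax.symm.reachable.trans ((reachable_of_preconnected_induce hC ha hb).trans hby.reachable)

/-- Every finite set `W` in one component has a balanced separator with at most `k` vertices: a set
that meets every connected set with more than half of `W`. -/
def HasBalancedSeparators (G : SimpleGraph V) (k : ℕ) : Prop :=
  ∀ W : Set V, W.Finite → (∀ x ∈ W, ∀ y ∈ W, G.Reachable x y) →
    ∃ X : Set V, X.Finite ∧ X.ncard ≤ k ∧
      ∀ K : Set V, (G.induce K).Preconnected → Disjoint K X → 2 * (W ∩ K).ncard ≤ W.ncard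

/-- A non-empty connected set whose boundary has at most `2 * k + 2` vertices. -/
structure IsGood (G : SimpleGraph V) (k : ℕ) (C : Set V) : Prop where
  nonempty : C.Nonempty
  preconnected : (G.induce C).Preconnected
  finite : (boundary G C).Finite
  ncard_le : (boundary G C).ncard ≤ 2 * k + 2

/-- A good set remains good in all its components when at most `k + 1` vertices are removed: a
balanced separator of its boundary, and a prescribed vertex `p`. -/
theorem HasBalancedSeparators.exists_removal {k : ℕ} (hsep : HasBalancedSeparators G k) {C : Set V}
    (hC : IsGood G k C) {p : V} (hp : p ∈ C) :
    ∃ T ⊆ C, p ∈ T ∧ T.Finite ∧ T.ncard ≤ k + 1 ∧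
      ∀ K ⊆ C \ T, K.Nonempty → (G.induce K).Preconnected → boundary G K ⊆ boundary G C ∪ T →
        IsGood G k K := by
  obtain ⟨X, hXfin, hXcard, hX⟩ := hsep _ hC.finite fun x hx y hy =>
    reachable_of_mem_boundary hC.preconnected hx hy
  have hTX : insert p (X ∩ C) ⊆ insert p X := Set.insert_subset_insert Set.inter_subset_left
  have hXp : (insert p X).ncard ≤ k + 1 := (Set.ncard_insert_le p X).trans (by omega)
  refine ⟨insert p (X ∩ C), Set.insert_subset hp Set.inter_subset_right, Set.mem_insert _ _,
    (hXfin.insert p).subset hTX, (Set.ncard_le_ncard hTX (hXfin.insert p)).trans hXp, ?_⟩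
  intro K hKC hKne hK hKb
  -- `K` with the part of its boundary outside `X` is connected and avoids `X`
  have hK' := preconnected_induce_union hK (Z := boundary G K \ X) fun z hz => hz.1.2
  have hdisj : Disjoint (K ∪ boundary G K \ X) X := by
    refine Set.disjoint_union_left.2 ⟨Set.disjoint_left.2 fun x hx hxX => ?_,
      Set.disjoint_sdiff_left⟩
    exact (hKC hx).2 (Or.inr ⟨hxX, (hKC hx).1⟩)
  have hhalf := hX _ hK' hdisj
  have hcover : boundary G K ⊆ (boundary G C ∩ (K ∪ boundary G K \ X)) ∪ insert p X := by
    intro z hz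
    by_cases hzX : z ∈ X
    · exact Or.inr (Or.inr hzX)
    · rcases hKb hz with h | h
      · exact Or.inl ⟨h, Or.inr ⟨hz, hzX⟩⟩
      · exact Or.inr (hTX h)
  have hfin := (hC.finite.inter_of_left (K ∪ boundary G K \ X)).union (hXfin.insert p)
  refine ⟨hKne, hK, hfin.subset hcover, ?_⟩
  have h1 := Set.ncard_le_ncard hcover hfin
  have h2 := Set.ncard_union_le (boundary G C ∩ (K ∪ boundary G K \ X)) (insert p X)
  have h3 := hC.ncard_le
  omega

/-- If all components are countable and balanced separators have at most `k` vertices, then there is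
a tree-decomposition with bags of at most `3 * k + 3` vertices. The function `e` enumerates the
components; removing from each piece its first vertex makes sure that every vertex is removed at
some level. -/
theorem HasBalancedSeparators.exists_treeDecomposition {k : ℕ} (hsep : HasBalancedSeparators G k)
    {e : V → ℕ} (he : ∀ x y, G.Reachable x y → e x = e y → x = y) :
    ∃ (X : Type u) (D : TreeDecomposition G X), ∀ x, (D.bag x).encard ≤ (3 * k + 3 : ℕ) := by
  classical
  have hA : ∀ C, ∃ T ⊆ C, (¬ IsGood G k C → T = ∅) ∧ (IsGood G k C →
      (∃ p ∈ T, ∀ w ∈ C, e p ≤ e w) ∧ T.Finite ∧ T.ncard ≤ k + 1 ∧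
      ∀ K ⊆ C \ T, K.Nonempty → (G.induce K).Preconnected → boundary G K ⊆ boundary G C ∪ T →
        IsGood G k K) := by
    intro C
    by_cases hC : IsGood G k C
    · have hmem := Function.argminOn_mem e C hC.nonempty
      obtain ⟨T, hTC, hpT, hT⟩ := hsep.exists_removal hC hmem
      exact ⟨T, hTC, fun h => absurd hC h, fun _ =>
        ⟨⟨_, hpT, fun w hw => Function.argminOn_le e C hw⟩, hT⟩⟩
    · exact ⟨∅, Set.empty_subset _, fun _ => rfl, fun h => absurd h hC⟩
  choose A hAC hAbad hAgood using hA
  have hbu : boundary G Set.univ = ∅ := Set.eq_empty_of_forall_notMem fun x hx => hx.1 trivial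
  -- the root may fail to be connected; then nothing is removed from it, and its components are good
  have hgood : ∀ n C, IsPiece G A (n + 1) C → IsGood G k C := by
    intro n
    induction n with
    | zero =>
      intro C hC
      cases hC with
      | child hP K =>
        cases hP
        have hne : (Subtype.val '' K.supp).Nonempty := K.nonempty_supp.image _
        have hb := boundary_image_supp_subset K
        by_cases hu : IsGood G k Set.univ
        · exact (hAgood _ hu).2.2.2 _ (image_supp_subset K) hne
            (preconnected_induce_image_supp K) hb
        · have hb' : boundary G (Subtype.val '' K.supp) = ∅ := Set.subset_empty_iff.1
            (hb.trans (by rw [hbu, hAbad _ hu, Set.union_empty]))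
          refine ⟨hne, preconnected_induce_image_supp K, ?_, ?_⟩
          · rw [hb']; exact Set.finite_empty
          · rw [hb', Set.ncard_empty]; omega
    | succ n ih =>
      intro C hC
      cases hC with
      | child hP K =>
        exact (hAgood _ (ih _ hP)).2.2.2 _ (image_supp_subset K) (K.nonempty_supp.image _)
          (preconnected_induce_image_supp K) (boundary_image_supp_subset K)
  -- the first vertex of the parent piece is gone, so the least value of `e` grows with the level
  have hlow : ∀ n C, IsPiece G A (n + 1) C → ∀ w ∈ C, n ≤ e w := by
    intro n
    induction n with
    | zero => intro _ _ _ _; exact Nat.zero_le _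
    | succ n ih =>
      intro C hC w hw
      obtain ⟨P, hP, hCP, _⟩ := hC.exists_parent
      have hPg := hgood n P hP
      obtain ⟨⟨p, hpT, hpmin⟩, _⟩ := hAgood P hPg
      have hwP := hCP hw
      have hne : e p ≠ e w := fun h => hwP.2 (by
        rwa [← he p w (reachable_of_preconnected_induce hPg.preconnected (hAC P hpT) hwP.1) h])
      have h1 := ih P hP p (hAC P hpT)
      have h2 := hpmin w hwP.1
      omega
  have hcov : ∀ v, ∃ n C, IsPiece G A n C ∧ v ∈ A C := by
    intro v
    by_contra! hcon
    have hall : ∀ n, ∃ C, IsPiece G A n C ∧ v ∈ C := by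
      intro n
      induction n with
      | zero => exact ⟨_, IsPiece.root, trivial⟩
      | succ n ih =>
        obtain ⟨C, hC, hvC⟩ := ih
        exact ⟨_, IsPiece.child hC (SimpleGraph.connectedComponentMk _ ⟨v, hvC, hcon n C hC⟩),
          _, rfl, rfl⟩
    obtain ⟨C, hC, hvC⟩ := hall (e v + 1 + 1)
    have := hlow _ C hC v hvC
    omega
  obtain ⟨X, D, hD⟩ := LinearGrowth.exists_treeDecomposition hAC hcov
  refine ⟨X, D, fun x => ?_⟩
  obtain ⟨n, C, hC, hbag⟩ := hD x
  rw [hbag]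
  by_cases hCg : IsGood G k C
  · obtain ⟨_, hfin, hcard, _⟩ := hAgood C hCg
    refine Set.encard_le_coe_iff_finite_ncard_le.2 ⟨hCg.finite.union hfin, ?_⟩
    have h1 := Set.ncard_union_le (boundary G C) (A C)
    have h2 := hCg.ncard_le
    omega
  · -- a piece that is not good is the root, whose bag is then empty
    cases n with
    | zero =>
      cases hC
      rw [hbu, hAbad _ hCg, Set.union_empty, Set.encard_empty]
      exact zero_le
    | succ n => exact absurd (hgood n C hC) hCg

theorem HasLinearBalls.exists_enumeration {c : ℝ} (hb : HasLinearBalls G c) :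
    ∃ e : V → ℕ, ∀ x y, G.Reachable x y → e x = e y → x = y := by
  have hcount : ∀ K : G.ConnectedComponent, K.supp.Countable := by
    intro K
    obtain ⟨v, rfl⟩ := K.exists_rep
    refine (Set.countable_iUnion fun n : ℕ => (hb v (n + 1) (by omega)).1.countable).mono ?_
    intro w hw
    have hr : G.Reachable v w := (SimpleGraph.ConnectedComponent.eq.1 hw).symm
    obtain ⟨p⟩ := hr
    exact Set.mem_iUnion.2 ⟨p.length, (SimpleGraph.edist_le p).trans
      (Nat.cast_le.2 (Nat.le_succ _))⟩
  choose f hf using fun K => (Set.countable_iff_exists_injOn.1 (hcount K))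
  refine ⟨fun v => f (G.connectedComponentMk v) v, fun x y hxy h => ?_⟩
  have hK : G.connectedComponentMk x = G.connectedComponentMk y :=
    SimpleGraph.ConnectedComponent.eq.2 hxy
  refine hf (G.connectedComponentMk y) hK rfl ?_
  simpa only [hK] using h

theorem TreeDecomposition.width_le {X : Type u} (D : TreeDecomposition G X) {m : ℕ}
    (h : ∀ x, (D.bag x).encard ≤ m) : D.width ≤ ((m - 1 : ℝ) : EReal) := by
  have h1 : (⨆ x, (D.bag x).encard) ≤ (m : ℕ∞) := iSup_le h
  have h2 : (((⨆ x, (D.bag x).encard : ℕ∞) : ENNReal) : EReal) ≤ ((m : ℝ) : EReal) := by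
    have h3 : (((⨆ x, (D.bag x).encard : ℕ∞) : ENNReal) : EReal) ≤ (((m : ℕ∞) : ENNReal) : EReal) :=
      by exact_mod_cast h1
    rw [ENat.toENNReal_coe] at h3
    exact h3
  rw [EReal.coe_sub]
  exact EReal.sub_le_sub h2 le_rfl

end LinearGrowth

theorem theorem1 {V : Type*} (G : SimpleGraph V) (c : ℝ) (hc : 1 ≤ c)
    (hG : ∀ r : ℕ, 1 ≤ r →
      ((LinearGrowth.growth G r : ENNReal) : EReal) ≤ ((c * (r : ℝ) : ℝ) : EReal)) :
    LinearGrowth.treewidth G ≤ ((49 * c ^ 2 + 30 * c : ℝ) : EReal) := by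
  have hb := LinearGrowth.hasLinearBalls_of_growth_le hG
  have hsep : LinearGrowth.HasBalancedSeparators G ⌊10 * c ^ 2⌋₊ := fun W hWfin hW => by
    obtain ⟨X, hXfin, hXcard, hX⟩ := hb.exists_balanced_separator hc hWfin hW
    exact ⟨X, hXfin, Nat.le_floor hXcard, hX⟩
  obtain ⟨e, he⟩ := hb.exists_enumeration
  obtain ⟨X, D, hD⟩ := hsep.exists_treeDecomposition he
  refine (iInf₂_le X D).trans ((D.width_le hD).trans (EReal.coe_le_coe_iff.2 ?_))
  have hk : (⌊10 * c ^ 2⌋₊ : ℝ) ≤ 10 * c ^ 2 := Nat.floor_le (by positivity)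
  push_cast
  nlinarith
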